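/- For a permutation $\sigma=\sigma_1\sigma_2\cdots\sigma_n$ of $\{1,\dots,n\}$ let $\mathrm{Des}(\sigma)=\{j : 1\le j\le n-1,\ \sigma_j>\sigma_{j+1}\}$ be its descent set and $\mathrm{maj}(\sigma)=\sum_{j\in \mathrm{Des}(\sigma)} j$ its major index. Say that $\sigma$ avoids $321$ if there are no $a<b<c$ with $\sigma_a>\sigma_b>\sigma_c$, and let $\mathcal S_n(321)$ be the set of $321$-avoiding permutations of $\{1,\dots,n\}$. For a partition $\lambda$ of $n$, a standard Young tableau $T$ of shape $\lambda$ is a filling of the Ferrers diagram of $\lambda$ (English convention) with the numbers $1,\dots,n$, each used once, that increases along rows from left to right and down columns; its descent set $\mathrm{Des}(T)$ is the set of those $j\in\{1,\dots,n-1\}$ that lie in a strictly higher row of $T$ than $j+1$, and $\mathrm{maj}(T)=\sum_{j\in \mathrm{Des}(T)} j$. For integers $n,i\ge 0$ and a partition $\lambda$ put $$A_{n,i}(q)=\sum_{\substack{\sigma\in\mathcal S_n(321)\\ |\mathrm{Des}(\sigma)|=i}} q^{\mathrm{maj}(\sigma)},\qquad f_{\lambda,i}(q)=\sum_{\substack{T\in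 \mathrm{SYT}(\lambda)\\ |\mathrm{Des}(T)|=i}} q^{\mathrm{maj}(T)},$$ where $\mathrm{SYT}(\lambda)$ is the set of standard Young tableaux of shape $\lambda$, and $(n,0)$ denotes the one-row partition $(n)$ (the empty partition if $n=0$). Then for all integers $n,i\ge 0$, as polynomials in $q$, $$A_{n,i}(q)=\sum_{k=i}^{\lfloor n/2\rfloor} f_{(n-k,k),i}(q)\cdot\binom{n}{k}\frac{n-2k+1}{n-k+1}.$$ (The sum is empty, hence $0$, if $i>\lfloor n/2\rfloor$.) -/

import Mathlib

namespace MajorIndex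

open Polynomial

/-! Permutations of length `n` are `Equiv.Perm (Fin n)`; the one-line notation of `σ` is
`σ 0, σ 1, …, σ (n - 1)`, so that the (1-based) place `j` is the index `j - 1 : Fin n`. -/

/-- `σ` avoids the pattern `π`: no subsequence of `σ` is order-isomorphic to `π`. -/
def Avoids {n k : ℕ} (σ : Equiv.Perm (Fin n)) (π : Equiv.Perm (Fin k)) : Prop :=
  ¬ ∃ p : Fin k → Fin n, (∀ a b, a < b → p a < p b) ∧
    ∀ a b, σ (p b) < σ (p a) ↔ π b < π a

instance {n k : ℕ} (σ : Equiv.Perm (Fin n)) (π : Equiv.Perm (Fin k)) :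
    Decidable (Avoids σ π) := by
  unfold Avoids; infer_instance

/-- The pattern `321`, i.e. the order-reversing permutation of three letters. -/
def pattern321 : Equiv.Perm (Fin 3) := Fin.revPerm

/-- The descent set of a permutation, as a set of 1-based places `j`:
`a` is the index of place `j` and `b` the index of place `j + 1`. -/
def permDes {n : ℕ} (σ : Equiv.Perm (Fin n)) : Finset ℕ :=
  (Finset.Icc 1 n).filter fun j =>
    ∃ a b : Fin n, (a : ℕ) + 1 = j ∧ (b : ℕ) + 1 = j + 1 ∧ σ b < σ a

/-- The major index of a permutation: the sum of its (1-based) descents. -/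
def permMaj {n : ℕ} (σ : Equiv.Perm (Fin n)) : ℕ := ∑ j ∈ permDes σ, j

/-- `A_{n,i}(q)`: the generating function for the major index over the `321`-avoiding permutations
of length `n` with exactly `i` descents. -/
noncomputable def A (n i : ℕ) : ℚ[X] :=
  ∑ σ : Equiv.Perm (Fin n) with Avoids σ pattern321 ∧ (permDes σ).card = i, X ^ permMaj σ

/-- `A n i` is the coefficient of `t ^ i` in `∑ q ^ maj σ * t ^ des σ`, the sum being over the
`321`-avoiding permutations of length `n`. -/
theorem A_eq_coeff (n i : ℕ) :
    A n i = (∑ σ : Equiv.Perm (Fin n) with Avoids σ pattern321,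
      (C (X ^ permMaj σ) * X ^ (permDes σ).card : ℚ[X][X])).coeff i := by
  simp only [A, finsetSum_coeff, coeff_C_mul, coeff_X_pow, mul_ite, mul_one, mul_zero,
    ← Finset.sum_filter, Finset.filter_filter, eq_comm (a := i)]

/-- Standard Young tableaux of shape `μ`: bijective fillings of the cells of `μ` (a cell is a pair
(row, column), row `0` being the top row) with the numbers `1, …, |μ|`, increasing along rows
(left to right) and along columns (top to bottom). -/
def SYT (μ : YoungDiagram) : Type :=
  {T : μ.cells ≃ Finset.Icc 1 μ.card //
    (∀ c d : μ.cells, c.1.1 = d.1.1 → c.1.2 < d.1.2 → (T c : ℕ) < T d) ∧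
    (∀ c d : μ.cells, c.1.2 = d.1.2 → c.1.1 < d.1.1 → (T c : ℕ) < T d)}

instance (μ : YoungDiagram) : Fintype (SYT μ) := by
  unfold SYT; infer_instance

/-- The descent set of a standard Young tableau: those `j` that lie in a strictly higher row than
`j + 1`. -/
def tabDes {μ : YoungDiagram} (T : SYT μ) : Finset ℕ :=
  (Finset.Icc 1 μ.card).filter fun j =>
    ∃ c d : μ.cells, (T.1 c : ℕ) = j ∧ (T.1 d : ℕ) = j + 1 ∧ c.1.1 < d.1.1

/-- The major index of a standard Young tableau: the sum of its descents. -/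
def tabMaj {μ : YoungDiagram} (T : SYT μ) : ℕ := ∑ j ∈ tabDes T, j

/-- `f_{μ,i}(q)`: the generating function for the major index over the standard Young tableaux of
shape `μ` with exactly `i` descents. -/
noncomputable def f (μ : YoungDiagram) (i : ℕ) : ℚ[X] :=
  ∑ T : SYT μ with (tabDes T).card = i, X ^ tabMaj T

/-- The Young diagram of the partition `(m, k)`, for `k ≤ m` (a single row if `k = 0`). -/
def twoRow (m k : ℕ) (h : k ≤ m) : YoungDiagram :=
  YoungDiagram.ofRowLens [m, k] (by simpa [List.sortedGE_iff_pairwise] using h)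

/-- `f_{(m,k),i}(q)`, with the convention that there are no tableaux of "shape" `(m, k)`
if `m < k`. -/
noncomputable def fTwoRow (m k i : ℕ) : ℚ[X] :=
  if h : k ≤ m then f (twoRow m k h) i else 0

end MajorIndex

namespace MajorIndex

open Polynomial

/-! ### Ballot words

A word in the letters `true` (up) and `false` (down) is a list whose head is the *last* letter. -/

/-! Row insertion matches permutations with pairs of standard tableaux of equal shape. Avoiding
`321` means at most two rows, and the descents of the permutation are those of the recording
tableau. For the shape `(n-k, k)` the insertion tableau is then free and contributes a ballot
number, while the recording tableau contributes `f`.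

A tableau with two rows is encoded as a ballot word, and the correspondence is replaced by a
comparison of recursions. A permutation grows by a last value `v`; a pair `(p, w)` grows by
inserting `v` into `p` and recording in `w` the row that grew. On each side the admissible `v` and
the new descent set depend only on a triple: the descent set, a flag (`lastIsMax`, resp. `pairFlag`)
and the least admissible `v` (`bottom`, resp. `stem`). The triples evolve by the same rule
(`sum_avoiders_succ`, `sum_ballotPairs_succ`), so they are equidistributed
(`sum_avoiders_eq_sum_ballotPairs`).

Grouping pairs by the number `k` of letters `false` (`sum_ballotPairs`), identifying the sum over
`w` with `f` (`fTwoRow_eq_sum_ballotWords`) and counting the words `p` (`card_ballotWords`) gives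
the formula. -/

/-- Every initial segment of the word has at least as many letters `true` as `false`. -/
def Ballot : List Bool → Prop
  | [] => True
  | c :: l => Ballot l ∧ (c :: l).count false ≤ (c :: l).count true

instance decidableBallot : (l : List Bool) → Decidable (Ballot l)
  | [] => isTrue trivial
  | _ :: l => @instDecidableAnd _ _ (decidableBallot l) _

/-- All words of length `n`. -/
def words : ℕ → Finset (List Bool)
  | 0 => {[]}
  | n + 1 => (words n).image (List.cons true) ∪ (words n).image (List.cons false)

@[simp] theorem mem_words {n : ℕ} {l : List Bool} : l ∈ words n ↔ l.length = n := by
  induction n generalizing l with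
  | zero => simp [words]
  | succ n ih =>
    cases l with
    | nil => simp [words]
    | cons c l => cases c <;> simp [words, ih]

theorem Ballot.count_le {l : List Bool} (h : Ballot l) : l.count false ≤ l.count true := by
  cases l with
  | nil => simp
  | cons c l => exact h.2

theorem ballot_true_cons {l : List Bool} : Ballot (true :: l) ↔ Ballot l := by
  refine ⟨fun h => h.1, fun h => ⟨h, ?_⟩⟩
  have := h.count_le
  simp
  omega

theorem ballot_false_cons {l : List Bool} :
    Ballot (false :: l) ↔ Ballot l ∧ l.count false + 1 ≤ l.count true := by
  simp [Ballot]

theorem ballot_replicate_true_append {x : ℕ} {l : List Bool} :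
    Ballot (List.replicate x true ++ l) ↔ Ballot l := by
  induction x with
  | zero => simp
  | succ x ih => simp [List.replicate_succ, ballot_true_cons, ih]

theorem ballot_replicate_false_append {y : ℕ} {l : List Bool} :
    Ballot (List.replicate y false ++ l) ↔ Ballot l ∧ y + l.count false ≤ l.count true := by
  induction y with
  | zero => simpa using Ballot.count_le
  | succ y ih =>
    simp only [List.replicate_succ, List.cons_append, ballot_false_cons, ih, List.count_append,
      List.count_replicate]
    simp
    constructor
    · rintro ⟨⟨h, -⟩, h'⟩
      exact ⟨h, by omega⟩
    · rintro ⟨h, h'⟩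
      exact ⟨⟨h, by omega⟩, by omega⟩

/-- The descent set of a word: the places of the letters `true` followed by a letter `false`. -/
def wordDes : List Bool → Finset ℕ
  | [] => ∅
  | c :: l => if c = false ∧ l.head? = some true then insert l.length (wordDes l) else wordDes l

/-- The length of what precedes the last run `false ⋯ false true ⋯ true` of a word. -/
def stem (l : List Bool) : ℕ := ((l.dropWhile (fun c => c)).dropWhile (fun c => !c)).length

theorem stem_true_cons (l : List Bool) : stem (true :: l) = stem l := by simp [stem]

theorem stem_replicate_le (x y : ℕ) (l : List Bool) :
    stem (List.replicate x true ++ (List.replicate y false ++ l)) ≤ l.length := by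
  induction x with
  | zero =>
    induction y with
    | zero =>
      exact ((List.dropWhile_suffix _).trans (List.dropWhile_suffix _)).length_le
    | succ y ih =>
      refine le_trans (le_of_eq ?_) (List.dropWhile_suffix (l := l) (fun c => !c)).length_le
      simp [stem, List.replicate_succ]
  | succ x ih => simpa [List.replicate_succ, stem_true_cons] using ih

theorem stem_replicate_eq (x y : ℕ) (l : List Bool) :
    stem (List.replicate x true ++ (List.replicate (y + 1) false ++ true :: l)) =
      l.length + 1 := by
  induction x with
  | zero => simp [stem, List.replicate_succ]
  | succ x ih => simpa [List.replicate_succ, stem_true_cons] using ih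

theorem exists_eq_replicate_false_append (l : List Bool) (v : ℕ)
    (hv : (l.dropWhile (fun c => !c)).length ≤ v) (hl : v ≤ l.length) :
    ∃ y r, l = List.replicate y false ++ r ∧ r.length = v := by
  induction l with
  | nil => exact ⟨0, [], by simp, by simp at hl ⊢; omega⟩
  | cons c l ih =>
    by_cases h : v = l.length + 1
    · exact ⟨0, c :: l, by simp, by simp [h]⟩
    · cases c with
      | true => simp at hv hl; omega
      | false =>
        obtain ⟨y, r, rfl, hr⟩ := ih (by simpa using hv) (by simp at hl; omega)
        exact ⟨y + 1, r, by simp [List.replicate_succ], hr⟩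

/-- A word can be cut at any place `v` not before its stem. -/
theorem exists_eq_replicate_append (l : List Bool) (v : ℕ)
    (hv : stem l ≤ v) (hl : v ≤ l.length) :
    ∃ x y r, l = List.replicate x true ++ (List.replicate y false ++ r) ∧ r.length = v := by
  induction l with
  | nil => exact ⟨0, 0, [], by simp, by simp at hl ⊢; omega⟩
  | cons c l ih =>
    by_cases h : v = l.length + 1
    · exact ⟨0, 0, c :: l, by simp, by simp [h]⟩
    · cases c with
      | true =>
        obtain ⟨x, y, r, rfl, hr⟩ := ih (by simpa [stem_true_cons] using hv) (by simp at hl; omega)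
        exact ⟨x + 1, y, r, by simp [List.replicate_succ], hr⟩
      | false =>
        obtain ⟨y, r, h1, hr⟩ :=
          exists_eq_replicate_false_append (false :: l) v (by simpa [stem] using hv) hl
        exact ⟨0, y, r, by simpa using h1, hr⟩

/-! ### Row insertion on words and its inverse -/

/-- Replace the first letter `true` of a word (the last one in the list) by `false`. -/
def bump : List Bool → List Bool
  | [] => []
  | c :: l => if true ∈ l then c :: bump l else false :: l

theorem bump_replicate_false (y : ℕ) :
    bump (List.replicate y false) = List.replicate y false := by
  cases y <;> simp [bump, List.replicate_succ]

theorem bump_replicate (x y : ℕ) :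
    bump (List.replicate (x + 1) true ++ List.replicate y false) =
      List.replicate x true ++ List.replicate (y + 1) false := by
  induction x with
  | zero => simp [bump, List.replicate_succ]
  | succ x ih =>
    rw [List.replicate_succ, List.cons_append, bump, if_pos (by simp), ih]
    simp [List.replicate_succ]

/-- Row insertion, on the word that records the row of every value of a tableau with two rows:
the new value exceeds exactly `v` of the old ones. -/
def insertValue (p : List Bool) (v : ℕ) : List Bool :=
  bump (p.take (p.length - v)) ++ true :: p.drop (p.length - v)

/-- The row which grows under `insertValue`. -/
def growsTop (p : List Bool) (v : ℕ) : Bool :=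
  !(p.head? == some true && decide (v < p.length))

/-- The inverse of `insertValue`, if the top row has grown (`true`) or the bottom row (`false`). -/
def deleteValue : Bool → List Bool → List Bool
  | true, l => l.erase true
  | false, [] => []
  | false, true :: l => true :: deleteValue false l
  | false, false :: l => true :: l.erase true

theorem erase_replicate_false_append (y : ℕ) (r : List Bool) :
    (List.replicate y false ++ true :: r).erase true = List.replicate y false ++ r := by
  rw [List.erase_append_right _ (by simp)]; simp

theorem deleteValue_replicate (x y : ℕ) (r : List Bool) :
    deleteValue false (List.replicate x true ++ (List.replicate (y + 1) false ++ true :: r)) =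
      List.replicate (x + 1) true ++ (List.replicate y false ++ r) := by
  induction x with
  | zero => simp [List.replicate_succ, deleteValue, erase_replicate_false_append]
  | succ x ih =>
    rw [List.replicate_succ, List.cons_append, deleteValue, ih]
    simp [List.replicate_succ]

/-- No entry of the top row exceeds the new value, so nothing is bumped. -/
theorem insertValue_replicate_false (y : ℕ) (r : List Bool) :
    insertValue (List.replicate y false ++ r) r.length =
      List.replicate y false ++ true :: r := by
  simp [insertValue, bump_replicate_false]

/-- The bumped value is the first of the trailing letters `true`. It exceeds all of the bottom row,
so it settles at the end of that row and no third row arises. -/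
theorem insertValue_replicate (x y : ℕ) (r : List Bool) :
    insertValue (List.replicate (x + 1) true ++ (List.replicate y false ++ r)) r.length =
      List.replicate x true ++ (List.replicate (y + 1) false ++ true :: r) := by
  have h : (List.replicate (x + 1) true ++ (List.replicate y false ++ r)).length - r.length
      = (List.replicate (x + 1) true ++ List.replicate y false).length := by
    simp; omega
  rw [insertValue, h, ← List.append_assoc, List.take_left, List.drop_left, bump_replicate]
  simp

/-- The pairs of ballot words of length `n` with equally many letters `false`. -/
def ballotPairs (n : ℕ) : Finset (List Bool × List Bool) :=
  (words n ×ˢ words n).filter fun c =>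
    Ballot c.1 ∧ Ballot c.2 ∧ c.1.count false = c.2.count false

theorem mem_ballotPairs {n : ℕ} {p w : List Bool} : (p, w) ∈ ballotPairs n ↔
    p.length = n ∧ w.length = n ∧ Ballot p ∧ Ballot w ∧ p.count false = w.count false := by
  simp [ballotPairs, and_assoc]

theorem count_true_add_count_false (l : List Bool) : l.count true + l.count false = l.length := by
  simp

/-- The pair of words ends in two letters `true`. -/
def pairFlag (p w : List Bool) : Bool := p.head? == some true && w.head? == some true

/-- Everything about `insertValue` that the recursion for pairs of ballot words uses. -/
theorem insertValue_spec {n : ℕ} {p w : List Bool} (h : (p, w) ∈ ballotPairs n) {v : ℕ}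
    (h1 : stem p ≤ v) (h2 : v ≤ n) :
    (insertValue p v, growsTop p v :: w) ∈ ballotPairs (n + 1) ∧
    deleteValue (growsTop p v) (insertValue p v) = p ∧
    pairFlag (insertValue p v) (growsTop p v :: w) = decide (v = n) ∧
    stem (insertValue p v) = if v = n then stem p else v + 1 := by
  obtain ⟨hp, hw, bp, bw, hc⟩ := mem_ballotPairs.1 h
  obtain ⟨x, y, r, rfl, rfl⟩ := exists_eq_replicate_append p v h1 (hp ▸ h2)
  have hcw := count_true_add_count_false w
  have hbw := bw.count_le
  have hcr := count_true_add_count_false r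
  rcases x with - | x
  -- Here the top row grows; the new pair ends in two letters `true` exactly when `y = 0`, that is,
  -- `v = n`.
  · simp only [List.replicate_zero, List.nil_append] at *
    rw [ballot_replicate_false_append] at bp
    obtain ⟨br, hle⟩ := bp
    have hg : growsTop (List.replicate y false ++ r) r.length = true := by
      cases y <;> simp [growsTop, List.replicate_succ]
    rw [hg, insertValue_replicate_false]
    refine ⟨?_, ?_, ?_, ?_⟩
    · rw [mem_ballotPairs, ballot_replicate_false_append, ballot_true_cons, ballot_true_cons]
      simp at hp hc ⊢
      refine ⟨by omega, by omega, ⟨br, by omega⟩, bw, by omega⟩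
    · rw [deleteValue, erase_replicate_false_append]
    · cases y with
      | zero => simp at hp; simp [pairFlag, hp]
      | succ y => simp at hp; simp [pairFlag, List.replicate_succ]; omega
    · cases y with
      | zero => simp at hp; simp [stem_true_cons, hp]
      | succ y =>
        simp at hp
        rw [if_neg (by omega)]
        exact stem_replicate_eq 0 y r
  -- Here a value is bumped and the bottom row grows, which forces `v < n`.
  · rw [ballot_replicate_true_append, ballot_replicate_false_append] at bp
    obtain ⟨br, hle⟩ := bp
    have hg : growsTop (List.replicate (x + 1) true ++ (List.replicate y false ++ r)) r.length =
        false := by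
      simp [growsTop, List.replicate_succ]
      omega
    rw [hg, insertValue_replicate]
    simp [List.count_replicate] at hp hc
    refine ⟨?_, deleteValue_replicate x y r, ?_, ?_⟩
    · rw [mem_ballotPairs, ballot_replicate_true_append, ballot_replicate_false_append,
        ballot_true_cons, ballot_false_cons]
      simp [List.count_replicate]
      refine ⟨by omega, by omega, ⟨br, by omega⟩, ⟨bw, by omega⟩, by omega⟩
    · simp [pairFlag]; omega
    · rw [if_neg (by omega), stem_replicate_eq]

/-- The value which `deleteValue` removes. -/
def deletedValue (p w : List Bool) : ℕ := if pairFlag p w then p.length - 1 else stem p - 1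

theorem exists_eq_replicate_false_append_true (l : List Bool) (h : true ∈ l) :
    ∃ y r, l = List.replicate y false ++ true :: r := by
  induction l with
  | nil => simp at h
  | cons c l ih =>
    cases c with
    | true => exact ⟨0, l, rfl⟩
    | false =>
      obtain ⟨y, r, rfl⟩ := ih (by simpa using h)
      exact ⟨y + 1, r, rfl⟩

/-- In a ballot word the last run of letters `false` cannot stand at the beginning. -/
theorem Ballot.exists_eq_replicate {l : List Bool} (hl : Ballot l) (h : false ∈ l) :
    ∃ x y r, l = List.replicate x true ++ (List.replicate (y + 1) false ++ true :: r) := by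
  induction l with
  | nil => simp at h
  | cons c l ih =>
    cases c with
    | true =>
      obtain ⟨x, y, r, rfl⟩ := ih hl.1 (by simpa using h)
      exact ⟨x + 1, y, r, rfl⟩
    | false =>
      obtain ⟨y, r, rfl⟩ := exists_eq_replicate_false_append_true l (by
        have := (ballot_false_cons.1 hl).2
        exact List.count_pos_iff.1 (by omega))
      exact ⟨0, y, r, rfl⟩

/-- The letter `u` tells which row grew, and that determines the insertion. If the top row grew, its
last entry was the new value. If the bottom row grew, its last entry was bumped by the last top
entry before it. -/
theorem deleteValue_spec {n : ℕ} {p w : List Bool} {u : Bool}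
    (h : (p, u :: w) ∈ ballotPairs (n + 1)) :
    (deleteValue u p, w) ∈ ballotPairs n ∧
    stem (deleteValue u p) ≤ deletedValue p (u :: w) ∧ deletedValue p (u :: w) ≤ n ∧
    insertValue (deleteValue u p) (deletedValue p (u :: w)) = p ∧
    growsTop (deleteValue u p) (deletedValue p (u :: w)) = u := by
  obtain ⟨hp, hw, bp, bw, hc⟩ := mem_ballotPairs.1 h
  have hcw := count_true_add_count_false w
  have hcp := count_true_add_count_false p
  have hbw := bw.1.count_le
  simp at hw
  cases u with
  | true =>
    have hc' : p.count false = w.count false := by simpa using hc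
    obtain ⟨y, r, rfl⟩ := exists_eq_replicate_false_append_true p
      (List.count_pos_iff.1 (by omega))
    have hd : deleteValue true (List.replicate y false ++ true :: r) =
        List.replicate y false ++ r := by
      rw [deleteValue, erase_replicate_false_append]
    rw [ballot_replicate_false_append, ballot_true_cons] at bp
    obtain ⟨br, hle⟩ := bp
    have hv : deletedValue (List.replicate y false ++ true :: r) (true :: w) = r.length := by
      cases y with
      | zero => simp [deletedValue, pairFlag]
      | succ y =>
        have := stem_replicate_eq 0 y r
        simp only [List.replicate_zero, List.nil_append] at this
        simp [deletedValue, pairFlag, this]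
        simp [List.replicate_succ]
    rw [hv, hd]
    have hcr := count_true_add_count_false r
    simp at hp hc' hle
    refine ⟨?_, stem_replicate_le 0 y r, by omega, insertValue_replicate_false y r, ?_⟩
    · rw [mem_ballotPairs, ballot_replicate_false_append]
      simp
      exact ⟨by omega, by omega, ⟨br, by omega⟩, bw.1, by omega⟩
    · cases y <;> simp [growsTop, List.replicate_succ]
  | false =>
    obtain ⟨x, y, r, rfl⟩ := bp.exists_eq_replicate
      (List.count_pos_iff.1 (by rw [hc]; simp))
    have hv : deletedValue (List.replicate x true ++ (List.replicate (y + 1) false ++ true :: r))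
        (false :: w) = r.length := by
      simp [deletedValue, pairFlag, stem_replicate_eq]
    rw [hv, deleteValue_replicate]
    rw [ballot_replicate_true_append, ballot_replicate_false_append, ballot_true_cons] at bp
    obtain ⟨br, hle⟩ := bp
    simp [List.count_replicate] at hp hc hle
    refine ⟨?_, stem_replicate_le _ y r, by omega, insertValue_replicate x y r, ?_⟩
    · rw [mem_ballotPairs, ballot_replicate_true_append, ballot_replicate_false_append]
      simp [List.count_replicate]
      exact ⟨by omega, by omega, ⟨br, by omega⟩, bw.1, by omega⟩
    · simp [growsTop, List.replicate_succ]; omega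

/-! ### The recursion for pairs of ballot words -/

/-- The descent set after a value is appended that exceeds exactly `v` of the old ones. -/
def nextDes (n : ℕ) (S : Finset ℕ) (b : Bool) (v : ℕ) : Finset ℕ :=
  if b = true ∧ v < n then insert n S else S

/-- A new descent needs `w` to end in `true` and the bottom row to grow; the latter means that `p`
ends in `true` and `v < n`. -/
theorem wordDes_growsTop_cons {n : ℕ} {p w : List Bool} (hp : p.length = n) (hw : w.length = n)
    (v : ℕ) :
    wordDes (growsTop p v :: w) = nextDes n (wordDes w) (pairFlag p w) v := by
  simp only [wordDes, nextDes, growsTop, pairFlag, hp, hw]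
  congr 1
  simp
  tauto

theorem sum_ballotPairs_succ {M : Type*} [AddCommMonoid M] (n : ℕ)
    (g : Finset ℕ → Bool → ℕ → M) :
    ∑ c ∈ ballotPairs (n + 1), g (wordDes c.2) (pairFlag c.1 c.2) (stem c.1) =
    ∑ c ∈ ballotPairs n, ∑ v ∈ Finset.Icc (stem c.1) n,
      g (nextDes n (wordDes c.2) (pairFlag c.1 c.2) v) (decide (v = n))
        (if v = n then stem c.1 else v + 1) := by
  rw [Finset.sum_sigma']
  symm
  refine Finset.sum_bij'
    (fun c _ => (insertValue c.1.1 c.2, growsTop c.1.1 c.2 :: c.1.2))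
    -- The default `true` is never used, since words of length `n + 1` are nonempty.
    (fun c _ => ⟨(deleteValue (c.2.headD true) c.1, c.2.tail), deletedValue c.1 c.2⟩)
    ?_ ?_ ?_ ?_ ?_
  · rintro ⟨⟨p, w⟩, v⟩ h
    simp only [Finset.mem_sigma, Finset.mem_Icc] at h
    exact (insertValue_spec h.1 h.2.1 h.2.2).1
  · rintro ⟨p, w⟩ h
    cases w with
    | nil => simp [mem_ballotPairs] at h
    | cons u w =>
      have := deleteValue_spec h
      simp only [Finset.mem_sigma, Finset.mem_Icc]
      exact ⟨this.1, this.2.1, this.2.2.1⟩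
  · rintro ⟨⟨p, w⟩, v⟩ h
    simp only [Finset.mem_sigma, Finset.mem_Icc] at h
    obtain ⟨h1, h2, h3, h4⟩ := insertValue_spec h.1 h.2.1 h.2.2
    have hl := (mem_ballotPairs.1 h1).1
    -- The flag detects `v = n`; otherwise the new stem is `v + 1`.
    have hv : deletedValue (insertValue p v) (growsTop p v :: w) = v := by
      rw [deletedValue, h3, h4, hl]
      by_cases hvn : v = n <;> simp [hvn]
    simp [h2, hv]
  · rintro ⟨p, w⟩ h
    cases w with
    | nil => simp [mem_ballotPairs] at h
    | cons u w =>
      have := deleteValue_spec h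
      simp [this.2.2.2]
  · rintro ⟨⟨p, w⟩, v⟩ h
    simp only [Finset.mem_sigma, Finset.mem_Icc] at h
    obtain ⟨h1, h2, h3, h4⟩ := insertValue_spec h.1 h.2.1 h.2.2
    obtain ⟨hp, hw, -⟩ := mem_ballotPairs.1 h.1
    simp only [h3, h4, wordDes_growsTop_cons hp hw]

/-! ### Permutations avoiding `321`, built by appending a last value -/

theorem avoids_pattern321_iff {n : ℕ} (σ : Equiv.Perm (Fin n)) :
    Avoids σ pattern321 ↔ ∀ a b c, a < b → b < c → σ b < σ a → ¬ σ c < σ b := by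
  constructor
  · intro h a b c hab hbc h1 h2
    refine h ⟨![a, b, c], ?_, ?_⟩
    · intro i j hij
      fin_cases i <;> fin_cases j <;> simp_all
      exact hab.trans hbc
    · intro i j
      fin_cases i <;> fin_cases j <;> simp [pattern321] <;> order
  · rintro h ⟨p, hp, hσ⟩
    exact h (p 0) (p 1) (p 2) (hp _ _ (by decide)) (hp _ _ (by decide))
      ((hσ 0 1).2 (by decide)) ((hσ 1 2).2 (by decide))

/-- Append a last value which exceeds exactly `v` of the old ones. -/
def appendValue {n : ℕ} (σ : Equiv.Perm (Fin n)) (v : Fin (n + 1)) : Equiv.Perm (Fin (n + 1)) :=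
  (finSuccEquiv' (Fin.last n)).trans ((Equiv.optionCongr σ).trans (finSuccEquiv' v).symm)

@[simp] theorem appendValue_last {n : ℕ} (σ : Equiv.Perm (Fin n)) (v : Fin (n + 1)) :
    appendValue σ v (Fin.last n) = v := by
  simp [appendValue]

@[simp] theorem appendValue_castSucc {n : ℕ} (σ : Equiv.Perm (Fin n)) (v : Fin (n + 1))
    (i : Fin n) : appendValue σ v i.castSucc = v.succAbove (σ i) := by
  have h := finSuccEquiv'_succAbove (Fin.last n) i
  rw [Fin.succAbove_last] at h
  simp [appendValue, h]

theorem appendValue_bijective (n : ℕ) : Function.Bijective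
    fun c : Equiv.Perm (Fin n) × Fin (n + 1) => appendValue c.1 c.2 := by
  rw [Fintype.bijective_iff_injective_and_card]
  constructor
  · rintro ⟨σ, v⟩ ⟨τ, w⟩ h
    simp only at h
    have hv : v = w := by rw [← appendValue_last σ v, h, appendValue_last]
    subst hv
    refine Prod.ext (Equiv.ext fun i => ?_) rfl
    have := congrArg (fun ρ : Equiv.Perm (Fin (n + 1)) => ρ i.castSucc) h
    simpa using this
  · simp [Fintype.card_perm, Nat.factorial_succ, mul_comm]

/-- The least `v` such that every value that is preceded by a larger one is less than `v`
(values are counted from `0`). -/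
def bottom {n : ℕ} (σ : Equiv.Perm (Fin n)) : ℕ :=
  Finset.univ.sup fun b => if ∃ a, a < b ∧ σ b < σ a then (σ b : ℕ) + 1 else 0

theorem bottom_le_iff {n : ℕ} (σ : Equiv.Perm (Fin n)) (v : ℕ) :
    bottom σ ≤ v ↔ ∀ a b, a < b → σ b < σ a → (σ b : ℕ) < v := by
  simp only [bottom, Finset.sup_le_iff, Finset.mem_univ, true_imp_iff]
  constructor
  · intro h a b hab hs
    have := h b
    rw [if_pos ⟨a, hab, hs⟩] at this
    omega
  · intro h b
    split_ifs with hb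
    · obtain ⟨a, hab, hs⟩ := hb
      exact h a b hab hs
    · omega

/-- The last value is the largest one. -/
def lastIsMax {n : ℕ} (σ : Equiv.Perm (Fin n)) : Bool :=
  decide (∃ i : Fin n, (i : ℕ) + 1 = n ∧ (σ i : ℕ) + 1 = n)

/-- A new decreasing triple must end at the last place, below the smaller value of some inversion of
`σ`. -/
theorem avoids_appendValue_iff {n : ℕ} (σ : Equiv.Perm (Fin n)) (v : Fin (n + 1)) :
    Avoids (appendValue σ v) pattern321 ↔ Avoids σ pattern321 ∧ bottom σ ≤ v := by
  rw [avoids_pattern321_iff, avoids_pattern321_iff, bottom_le_iff]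
  constructor
  · intro h
    refine ⟨fun a b c hab hbc h1 h2 => ?_, fun a b hab h1 => ?_⟩
    · refine h a.castSucc b.castSucc c.castSucc (by simpa using hab) (by simpa using hbc) ?_ ?_
      · simpa using h1
      · simpa using h2
    · by_contra hv
      refine h a.castSucc b.castSucc (Fin.last n) (by simpa using hab) (Fin.castSucc_lt_last _)
        ?_ ?_
      · simpa using h1
      · rw [appendValue_last, appendValue_castSucc, Fin.lt_succAbove_iff_le_castSucc, Fin.le_def]
        simpa using hv
  · rintro ⟨h, hv⟩ a b c hab hbc
    obtain ⟨b, rfl⟩ := Fin.exists_castSucc_eq.2 (hbc.trans_le (Fin.le_last c)).ne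
    obtain ⟨a, rfl⟩ := Fin.exists_castSucc_eq.2 (hab.trans_le (Fin.le_last _)).ne
    rw [Fin.castSucc_lt_castSucc_iff] at hab
    rw [appendValue_castSucc, appendValue_castSucc, Fin.succAbove_lt_succAbove_iff]
    intro h1
    induction c using Fin.lastCases with
    | last =>
      rw [appendValue_last, Fin.lt_succAbove_iff_le_castSucc, Fin.le_def, not_le]
      exact hv a b hab h1
    | cast c =>
      rw [appendValue_castSucc, Fin.succAbove_lt_succAbove_iff]
      exact h a b c hab (by simpa using hbc) h1

theorem lastIsMax_appendValue {n : ℕ} (σ : Equiv.Perm (Fin n)) (v : Fin (n + 1)) :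
    lastIsMax (appendValue σ v) = decide ((v : ℕ) = n) := by
  rw [lastIsMax]
  congr 1
  simp only [eq_iff_iff, Nat.add_right_cancel_iff]
  constructor
  · rintro ⟨i, hi, h⟩
    obtain rfl : i = Fin.last n := Fin.ext hi
    simpa using h
  · exact fun h => ⟨Fin.last n, by simp, by simpa using h⟩

/-- Values below `v` keep their size, and these include all that are preceded by a larger one. The
value `v` itself joins them unless it is the new maximum. -/
theorem bottom_appendValue {n : ℕ} (σ : Equiv.Perm (Fin n)) (v : Fin (n + 1))
    (hv : bottom σ ≤ v) :
    bottom (appendValue σ v) = if (v : ℕ) = n then bottom σ else (v : ℕ) + 1 := by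
  have hb := (bottom_le_iff σ v).1 hv
  have hle : ∀ w : ℕ, bottom (appendValue σ v) ≤ w ↔
      bottom σ ≤ w ∧ ((v : ℕ) < n → (v : ℕ) < w) := by
    intro w
    rw [bottom_le_iff, bottom_le_iff]
    have key : ∀ a b, a < b → σ b < σ a → (v.succAbove (σ b) : ℕ) = σ b := fun a b hab h => by
      rw [Fin.succAbove_of_castSucc_lt _ _ (by rw [Fin.lt_def]; exact hb a b hab h)]
      simp
    constructor
    · intro h
      refine ⟨fun a b hab h1 => ?_, fun hvn => ?_⟩
      · have := h a.castSucc b.castSucc (by simpa using hab) (by simpa using h1)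
        rwa [appendValue_castSucc, key a b hab h1] at this
      -- The old maximum precedes the last place and exceeds the new value when `v < n`.
      · have := h (σ.symm ⟨n - 1, by omega⟩).castSucc (Fin.last n) (Fin.castSucc_lt_last _) (by
          rw [appendValue_last, appendValue_castSucc, Fin.lt_succAbove_iff_le_castSucc, Fin.le_def]
          simp
          omega)
        rwa [appendValue_last] at this
    · rintro ⟨h, hvw⟩ a b hab
      obtain ⟨a, rfl⟩ := Fin.exists_castSucc_eq.2 (hab.trans_le (Fin.le_last _)).ne
      rw [appendValue_castSucc]
      induction b using Fin.lastCases with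
      | last =>
        rw [appendValue_last, Fin.lt_succAbove_iff_le_castSucc, Fin.le_def]
        intro h1
        exact hvw (lt_of_le_of_lt h1 (σ a).isLt)
      | cast b =>
        rw [appendValue_castSucc, Fin.succAbove_lt_succAbove_iff]
        intro h1
        rw [Fin.castSucc_lt_castSucc_iff] at hab
        rw [key a b hab h1]
        exact h a b hab h1
  have hvn := v.isLt
  refine eq_of_forall_ge_iff fun w => ?_
  rw [hle]
  split_ifs <;> omega

theorem lt_succAbove_val_iff {n : ℕ} (v : Fin (n + 1)) (x : Fin n) :
    v < v.succAbove x ↔ (v : ℕ) ≤ x := by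
  rw [Fin.lt_succAbove_iff_le_castSucc, Fin.le_def, Fin.val_castSucc]

/-- Only the place `n` can become a descent. If the old last value is not the maximum, the maximum
precedes it, so it lies below `bottom σ ≤ v` and there is no descent. -/
theorem permDes_appendValue {n : ℕ} (σ : Equiv.Perm (Fin n)) (v : Fin (n + 1))
    (hv : bottom σ ≤ v) :
    permDes (appendValue σ v) = nextDes n (permDes σ) (lastIsMax σ) v := by
  have hb := (bottom_le_iff σ v).1 hv
  have hlast : ∀ i : Fin n, (i : ℕ) + 1 = n →
      ((v : ℕ) ≤ σ i ↔ lastIsMax σ = true ∧ (v : ℕ) < n) := by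
    intro i hi
    simp only [lastIsMax, decide_eq_true_eq]
    have hi' := (σ i).isLt
    constructor
    · intro h
      refine ⟨⟨i, hi, ?_⟩, by omega⟩
      by_contra hne
      set a := σ.symm ⟨n - 1, by omega⟩ with ha
      have hσa : σ a = ⟨n - 1, by omega⟩ := by simp [ha]
      have hai : a ≠ i := by
        rintro h'
        rw [h', Fin.ext_iff] at hσa
        simp at hσa
        omega
      have := hb a i (by rw [Fin.lt_def]; have := a.isLt; rw [Ne, Fin.ext_iff] at hai; omega)
        (by rw [hσa, Fin.lt_def]; simp; omega)
      omega
    · rintro ⟨⟨j, hj, h⟩, h'⟩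
      obtain rfl : j = i := Fin.ext (by omega)
      omega
  have hmem : ∀ j, j ∈ permDes (appendValue σ v) ↔
      j ∈ permDes σ ∨ (j = n ∧ lastIsMax σ = true ∧ (v : ℕ) < n) := by
    intro j
    simp only [permDes, Finset.mem_filter, Finset.mem_Icc]
    constructor
    · rintro ⟨hj, a, b, rfl, hab, h⟩
      have ha : a ≠ Fin.last n := by
        rintro rfl
        have := b.isLt
        simp at hab
        omega
      obtain ⟨a, rfl⟩ := Fin.exists_castSucc_eq.2 ha
      rw [appendValue_castSucc] at h
      induction b using Fin.lastCases with
      | last =>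
        rw [appendValue_last, lt_succAbove_val_iff] at h
        simp at hab
        exact Or.inr ⟨by simp; omega, (hlast a (by omega)).1 h⟩
      | cast b =>
        rw [appendValue_castSucc, Fin.succAbove_lt_succAbove_iff] at h
        simp at hab
        refine Or.inl ⟨⟨by simp, by simp⟩, a, b, by simp, by simp; omega, h⟩
    · rintro (⟨hj, a, b, rfl, hab, h⟩ | ⟨rfl, h⟩)
      · exact ⟨by omega, a.castSucc, b.castSucc, by simp, by simpa using hab, by simpa using h⟩
      · refine ⟨by omega, (⟨j - 1, by omega⟩ : Fin j).castSucc, Fin.last j, by simp; omega,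
          by simp, ?_⟩
        rw [appendValue_last, appendValue_castSucc, lt_succAbove_val_iff]
        exact (hlast _ (by simp; omega)).2 h
  ext j
  rw [hmem, nextDes]
  split_ifs with h
  · simp [h, or_comm]
  · simp [h]

theorem sum_avoiders_succ {M : Type*} [AddCommMonoid M] (n : ℕ)
    (g : Finset ℕ → Bool → ℕ → M) :
    ∑ σ : Equiv.Perm (Fin (n + 1)) with Avoids σ pattern321,
      g (permDes σ) (lastIsMax σ) (bottom σ) =
    ∑ σ : Equiv.Perm (Fin n) with Avoids σ pattern321, ∑ v ∈ Finset.Icc (bottom σ) n,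
      g (nextDes n (permDes σ) (lastIsMax σ) v) (decide (v = n))
        (if v = n then bottom σ else v + 1) := by
  rw [Finset.sum_filter, ← (appendValue_bijective n).sum_comp, Fintype.sum_prod_type,
    Finset.sum_filter]
  refine Finset.sum_congr rfl fun σ _ => ?_
  split_ifs with hσ
  · have hI : Finset.Icc (bottom σ) n = (Finset.range (n + 1)).filter (bottom σ ≤ ·) := by
      ext v
      simp
      omega
    rw [hI, Finset.sum_filter, Finset.sum_range]
    refine Finset.sum_congr rfl fun v _ => ?_
    simp only [avoids_appendValue_iff, hσ, true_and]
    split_ifs with hv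
    all_goals simp_all [permDes_appendValue, lastIsMax_appendValue, bottom_appendValue]
  · exact Finset.sum_eq_zero fun v _ => by simp [avoids_appendValue_iff, hσ]

/-- The joint distribution of descent sets over `321`-avoiding permutations, in terms of pairs of
ballot words. -/
theorem sum_avoiders_eq_sum_ballotPairs {M : Type*} [AddCommMonoid M] (n : ℕ)
    (g : Finset ℕ → Bool → ℕ → M) :
    ∑ σ : Equiv.Perm (Fin n) with Avoids σ pattern321,
      g (permDes σ) (lastIsMax σ) (bottom σ) =
    ∑ c ∈ ballotPairs n, g (wordDes c.2) (pairFlag c.1 c.2) (stem c.1) := by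
  induction n generalizing g with
  | zero =>
    have h1 : (Finset.univ.filter fun σ : Equiv.Perm (Fin 0) => Avoids σ pattern321) = {1} := by
      ext σ
      simp [avoids_pattern321_iff, Subsingleton.elim σ 1]
    have h2 : ballotPairs 0 = {([], [])} := by decide
    rw [h1, h2]
    simp [permDes, wordDes, lastIsMax, pairFlag, bottom, stem]
  | succ n ih =>
    rw [sum_avoiders_succ, sum_ballotPairs_succ]
    -- The inner sum depends on the triple alone, so it serves as the new `g`; hence the induction
    -- over all `g`.
    exact ih fun S b z => ∑ v ∈ Finset.Icc z n, g (nextDes n S b v) (decide (v = n))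
      (if v = n then z else v + 1)

/-! ### Standard Young tableaux with two rows as ballot words -/

/-- The word of length `n` with letters `r 1, …, r n`. -/
def wordOf (r : ℕ → Bool) : ℕ → List Bool
  | 0 => []
  | n + 1 => r (n + 1) :: wordOf r n

@[simp] theorem length_wordOf (r : ℕ → Bool) (n : ℕ) : (wordOf r n).length = n := by
  induction n with
  | zero => rfl
  | succ n ih => simp [wordOf, ih]

theorem wordOf_eq_iff {r s : ℕ → Bool} {n : ℕ} :
    wordOf r n = wordOf s n ↔ ∀ j ∈ Finset.Icc 1 n, r j = s j := by
  induction n with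
  | zero => simp [wordOf]
  | succ n ih =>
    simp only [wordOf, List.cons.injEq, ih, Finset.mem_Icc]
    constructor
    · rintro ⟨h, h'⟩ j hj
      rcases Nat.lt_or_ge n j with hn | hn
      · obtain rfl : j = n + 1 := by omega
        exact h
      · exact h' j ⟨hj.1, hn⟩
    · exact fun h => ⟨h _ ⟨by omega, le_rfl⟩, fun j hj => h j ⟨hj.1, by omega⟩⟩

theorem exists_eq_wordOf (w : List Bool) : ∃ r, w = wordOf r w.length := by
  induction w with
  | nil => exact ⟨fun _ => true, rfl⟩
  | cons c w ih =>
    obtain ⟨r, hr⟩ := ih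
    refine ⟨fun j => if j = w.length + 1 then c else r j, ?_⟩
    simp only [List.length_cons, wordOf, if_true]
    congr 1
    refine hr.trans (wordOf_eq_iff.2 fun j hj => ?_)
    rw [Finset.mem_Icc] at hj
    rw [if_neg (by omega)]

theorem count_wordOf (r : ℕ → Bool) (b : Bool) (n : ℕ) :
    (wordOf r n).count b = ((Finset.Icc 1 n).filter fun j => r j = b).card := by
  induction n with
  | zero => simp [wordOf]
  | succ n ih =>
    rw [wordOf, List.count_cons, ih, ← Finset.insert_Icc_right_eq_Icc_add_one (by omega),
      Finset.filter_insert]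
    by_cases h : r (n + 1) = b <;> simp [h]

theorem ballot_wordOf_iff (r : ℕ → Bool) (n : ℕ) :
    Ballot (wordOf r n) ↔ ∀ j ≤ n, (wordOf r j).count false ≤ (wordOf r j).count true := by
  induction n with
  | zero => simp [wordOf, Ballot]
  | succ n ih =>
    rw [wordOf, Ballot, ih, ← wordOf]
    constructor
    · rintro ⟨h, h'⟩ j hj
      rcases Nat.lt_or_ge n j with hn | hn
      · obtain rfl : j = n + 1 := by omega
        exact h'
      · exact h j hn
    · exact fun h => ⟨fun j hj => h j (by omega), h _ le_rfl⟩

theorem mem_wordDes_wordOf {r : ℕ → Bool} {n j : ℕ} : j ∈ wordDes (wordOf r n) ↔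
    1 ≤ j ∧ j + 1 ≤ n ∧ r j = true ∧ r (j + 1) = false := by
  induction n with
  | zero => simp [wordOf, wordDes]
  | succ n ih =>
    have hh : (wordOf r n).head? = some true ↔ 1 ≤ n ∧ r n = true := by
      cases n <;> simp [wordOf]
    rw [wordOf, wordDes, length_wordOf]
    simp only [hh]
    by_cases hj : j = n
    · subst hj
      split_ifs with h
      · simp [h]
      · rw [ih]
        constructor
        · omega
        · rintro ⟨h1, -, h2, h3⟩
          exact absurd ⟨h3, h1, h2⟩ h
    · have : j + 1 ≤ n + 1 ↔ j + 1 ≤ n := by omega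
      split_ifs <;> simp [ih, hj] <;> omega

/-- The entry of a tableau in row `i` and column `c` (`0` outside the diagram). -/
def entry {μ : YoungDiagram} (T : SYT μ) (i c : ℕ) : ℕ :=
  if h : (i, c) ∈ μ.cells then (T.1 ⟨(i, c), h⟩ : ℕ) else 0

/-- The entry `j` lies in row `i`. -/
def InRow {μ : YoungDiagram} (T : SYT μ) (i j : ℕ) : Prop :=
  ∃ c : μ.cells, (T.1 c : ℕ) = j ∧ c.1.1 = i

theorem mem_cells_iff {μ : YoungDiagram} {i c : ℕ} : (i, c) ∈ μ.cells ↔ c < μ.rowLen i := by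
  rw [YoungDiagram.mem_cells, YoungDiagram.mem_iff_lt_rowLen]

theorem entry_lt_entry {μ : YoungDiagram} (T : SYT μ) {i c d : ℕ} (hcd : c < d)
    (hd : d < μ.rowLen i) : entry T i c < entry T i d := by
  rw [entry, entry, dif_pos (mem_cells_iff.2 (hcd.trans hd)), dif_pos (mem_cells_iff.2 hd)]
  exact T.2.1 _ _ rfl hcd

theorem inRow_iff {μ : YoungDiagram} (T : SYT μ) {i j : ℕ} :
    InRow T i j ↔ ∃ c < μ.rowLen i, entry T i c = j := by
  constructor
  · rintro ⟨⟨⟨i, c⟩, h⟩, hj, rfl⟩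
    exact ⟨c, mem_cells_iff.1 h, by rw [entry, dif_pos h, hj]⟩
  · rintro ⟨c, hc, h⟩
    rw [entry, dif_pos (mem_cells_iff.2 hc)] at h
    exact ⟨_, h, rfl⟩

theorem InRow.mem_Icc {μ : YoungDiagram} {T : SYT μ} {i j : ℕ} (h : InRow T i j) :
    j ∈ Finset.Icc 1 μ.card := by
  obtain ⟨c, rfl, -⟩ := h
  exact (T.1 c).2

theorem InRow.unique {μ : YoungDiagram} {T : SYT μ} {i i' j : ℕ} (h : InRow T i j)
    (h' : InRow T i' j) : i = i' := by
  obtain ⟨c, hc, rfl⟩ := h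
  obtain ⟨d, hd, rfl⟩ := h'
  rw [T.1.injective (Subtype.ext (hc.trans hd.symm))]

/-- A standard Young tableau is determined by the rows of its entries. -/
theorem SYT.ext_inRow {μ : YoungDiagram} {T T' : SYT μ}
    (h : ∀ i j, InRow T i j ↔ InRow T' i j) : T = T' := by
  have key : ∀ i, (fun c : Fin (μ.rowLen i) => entry T i c) =
      fun c : Fin (μ.rowLen i) => entry T' i c := by
    intro i
    have hs : ∀ S : SYT μ, StrictMono fun c : Fin (μ.rowLen i) => entry S i c :=
      fun S c d hcd => entry_lt_entry S hcd d.2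
    -- A row increases strictly, so its set of entries determines it.
    refine (StrictMono.range_inj (hs T) (hs T')).1 ?_
    ext j
    have := h i j
    rw [inRow_iff, inRow_iff] at this
    simpa [Fin.exists_iff] using this
  refine Subtype.ext (Equiv.ext fun c => Subtype.ext ?_)
  obtain ⟨⟨i, c⟩, hc⟩ := c
  have := congrFun (key i) ⟨c, mem_cells_iff.1 hc⟩
  simpa [entry, hc] using this

open Classical in
theorem card_inRow {μ : YoungDiagram} (T : SYT μ) (i j : ℕ) :
    ((Finset.Icc 1 j).filter fun x => InRow T i x).card =
      ((Finset.range (μ.rowLen i)).filter fun c => entry T i c ≤ j).card := by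
  symm
  refine Finset.card_bij (fun c _ => entry T i c) ?_ ?_ ?_
  · intro c hc
    rw [Finset.mem_filter, Finset.mem_range] at hc
    have hr : InRow T i (entry T i c) := (inRow_iff T).2 ⟨c, hc.1, rfl⟩
    rw [Finset.mem_filter, Finset.mem_Icc]
    exact ⟨⟨(Finset.mem_Icc.1 hr.mem_Icc).1, hc.2⟩, hr⟩
  · intro c hc d hd h
    rw [Finset.mem_filter, Finset.mem_range] at hc hd
    rcases lt_trichotomy c d with hcd | hcd | hcd
    · exact absurd h (entry_lt_entry T hcd hd.1).ne
    · exact hcd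
    · exact absurd h (entry_lt_entry T hcd hc.1).ne'
  · intro x hx
    rw [Finset.mem_filter, Finset.mem_Icc, inRow_iff] at hx
    obtain ⟨hx, c, hc, rfl⟩ := hx
    exact ⟨c, by simp [hc, hx.2], rfl⟩

theorem mem_twoRow {m k : ℕ} {h : k ≤ m} {i c : ℕ} :
    (i, c) ∈ (twoRow m k h).cells ↔ (i = 0 ∧ c < m) ∨ (i = 1 ∧ c < k) := by
  rw [YoungDiagram.mem_cells, twoRow, YoungDiagram.mem_ofRowLens]
  rcases i with - | - | i <;> simp

theorem rowLen_twoRow_zero {m k : ℕ} {h : k ≤ m} : (twoRow m k h).rowLen 0 = m := by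
  refine eq_of_forall_lt_iff fun c => ?_
  rw [← mem_cells_iff, mem_twoRow]
  simp

theorem rowLen_twoRow_one {m k : ℕ} {h : k ≤ m} : (twoRow m k h).rowLen 1 = k := by
  refine eq_of_forall_lt_iff fun c => ?_
  rw [← mem_cells_iff, mem_twoRow]
  simp

theorem card_twoRow {m k : ℕ} {h : k ≤ m} : (twoRow m k h).card = m + k := by
  have : (twoRow m k h).cells = ({0} ×ˢ Finset.range m).disjUnion ({1} ×ˢ Finset.range k)
      (by rw [Finset.disjoint_left]; rintro ⟨i, c⟩; simp; omega) := by
    ext ⟨i, c⟩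
    rw [mem_twoRow]
    simp [and_comm, eq_comm]
  rw [YoungDiagram.card, this, Finset.card_disjUnion]
  simp

/-- The word of a tableau with two rows: the letter `true` stands for the top row. -/
noncomputable def tabWord {μ : YoungDiagram} (T : SYT μ) : List Bool :=
  open Classical in wordOf (fun j => decide (InRow T 0 j)) μ.card

theorem not_inRow_zero_iff {m k : ℕ} {h : k ≤ m} (T : SYT (twoRow m k h)) {j : ℕ}
    (hj : j ∈ Finset.Icc 1 (twoRow m k h).card) : ¬ InRow T 0 j ↔ InRow T 1 j := by
  constructor
  · intro h0
    obtain ⟨⟨⟨i, c⟩, hc⟩, hT⟩ := T.1.surjective ⟨j, hj⟩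
    rw [Subtype.ext_iff] at hT
    rcases mem_twoRow.1 hc with ⟨rfl, -⟩ | ⟨rfl, -⟩
    · exact absurd ⟨_, hT, rfl⟩ h0
    · exact ⟨_, hT, rfl⟩
  · exact fun h1 h0 => absurd (h0.unique h1) (by decide)

theorem wordDes_tabWord {m k : ℕ} {h : k ≤ m} (T : SYT (twoRow m k h)) :
    wordDes (tabWord T) = tabDes T := by
  classical
  ext j
  rw [tabWord, mem_wordDes_wordOf, tabDes, Finset.mem_filter, Finset.mem_Icc]
  simp only [decide_eq_true_eq, decide_eq_false_iff_not]
  constructor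
  · rintro ⟨h1, h2, h3, h4⟩
    rw [not_inRow_zero_iff T (Finset.mem_Icc.2 ⟨by omega, h2⟩)] at h4
    obtain ⟨c, hc, hc0⟩ := h3
    obtain ⟨d, hd, hd1⟩ := h4
    exact ⟨⟨h1, by omega⟩, c, d, hc, hd, by omega⟩
  · rintro ⟨hj, ⟨⟨i, c⟩, hc⟩, ⟨⟨i', d⟩, hd⟩, hTc, hTd, hlt⟩
    have hd' := Finset.mem_Icc.1 (T.1 ⟨(i', d), hd⟩).2
    rw [hTd] at hd'
    simp only at hlt
    obtain rfl : i = 0 := by rcases mem_twoRow.1 hd with h | h <;> omega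
    obtain rfl : i' = 1 := by rcases mem_twoRow.1 hd with h | h <;> omega
    refine ⟨hj.1, hd'.2, ⟨_, hTc, rfl⟩, fun h0 => ?_⟩
    exact absurd (h0.unique (i' := 1) ⟨_, hTd, rfl⟩) (by decide)

theorem count_tabWord {m k : ℕ} {h : k ≤ m} (T : SYT (twoRow m k h)) (b : Bool) {j : ℕ}
    (hj : j ≤ m + k) : open Classical in
    (wordOf (fun j => decide (InRow T 0 j)) j).count b =
      ((Finset.range (if b then m else k)).filter
        fun c => entry T (if b then 0 else 1) c ≤ j).card := by
  classical
  rw [count_wordOf]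
  cases b with
  | true =>
    have := card_inRow T 0 j
    rw [rowLen_twoRow_zero] at this
    simpa using this
  | false =>
    have := card_inRow T 1 j
    rw [rowLen_twoRow_one] at this
    simp only [Bool.false_eq_true, if_false]
    rw [← this]
    congr 1
    refine Finset.filter_congr fun x hx => ?_
    rw [Finset.mem_Icc] at hx
    rw [← not_inRow_zero_iff T (by rw [Finset.mem_Icc, card_twoRow]; omega)]
    simp

/-- The ballot words of length `n` with `k` letters `false`. -/
def ballotWords (n k : ℕ) : Finset (List Bool) :=
  (words n).filter fun w => Ballot w ∧ w.count false = k

/-- The word is ballot because each bottom entry has a smaller top entry above it in its column. -/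
theorem tabWord_mem {m k : ℕ} {h : k ≤ m} (T : SYT (twoRow m k h)) :
    tabWord T ∈ ballotWords (m + k) k := by
  classical
  have hlt : ∀ i c, entry T i c ≤ m + k := by
    intro i c
    rw [entry]
    split_ifs with hc
    · exact (Finset.mem_Icc.1 (T.1 ⟨(i, c), hc⟩).2).2.trans card_twoRow.le
    · omega
  rw [ballotWords, Finset.mem_filter, mem_words, tabWord, card_twoRow, length_wordOf]
  refine ⟨rfl, (ballot_wordOf_iff _ _).2 fun j hj => ?_, ?_⟩
  · rw [count_tabWord T _ hj, count_tabWord T _ hj]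
    refine Finset.card_le_card fun c => ?_
    simp only [Finset.mem_filter, Finset.mem_range, Bool.false_eq_true, if_false, if_true]
    rintro ⟨hc, hj⟩
    refine ⟨by omega, le_trans (le_of_lt ?_) hj⟩
    rw [entry, entry, dif_pos (mem_twoRow.2 (by omega)), dif_pos (mem_twoRow.2 (by omega))]
    exact T.2.2 _ _ rfl (by simp)
  · rw [count_tabWord T _ le_rfl]
    simp [hlt]

theorem tabWord_injective {m k : ℕ} {h : k ≤ m} :
    Function.Injective (tabWord : SYT (twoRow m k h) → List Bool) := by
  classical
  intro T T' hT
  rw [tabWord, tabWord, wordOf_eq_iff] at hT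
  have h0 : ∀ j, InRow T 0 j ↔ InRow T' 0 j := fun j => by
    by_cases hj : j ∈ Finset.Icc 1 (twoRow m k h).card
    · simpa using hT j hj
    · exact ⟨fun h => absurd h.mem_Icc hj, fun h => absurd h.mem_Icc hj⟩
  refine SYT.ext_inRow fun i j => ?_
  by_cases hj : j ∈ Finset.Icc 1 (twoRow m k h).card
  · have hrow : ∀ {S : SYT (twoRow m k h)}, InRow S i j → i = 0 ∨ i = 1 := by
      rintro S ⟨⟨⟨i, c⟩, hc⟩, -, rfl⟩
      have := mem_twoRow.1 hc
      simp only
      omega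
    by_cases hi : i = 0 ∨ i = 1
    · rcases hi with rfl | rfl
      · exact h0 j
      · rw [← not_inRow_zero_iff T hj, ← not_inRow_zero_iff T' hj, h0]
    · exact ⟨fun h => absurd (hrow h) hi, fun h => absurd (hrow h) hi⟩
  · exact ⟨fun h => absurd h.mem_Icc hj, fun h => absurd h.mem_Icc hj⟩

/-! ### From ballot words back to tableaux -/

theorem card_toFinset_mem (R : Finset ℕ) (h : {j | j ∈ R}.Finite) : h.toFinset.card = R.card := by
  congr 1
  ext
  simp

theorem nth_mem_finset {R : Finset ℕ} {c : ℕ} (hc : c < R.card) : Nat.nth (· ∈ R) c ∈ R :=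
  Nat.nth_mem_of_lt_card R.finite_toSet (by rwa [card_toFinset_mem])

theorem nth_finset_lt {R : Finset ℕ} {c d : ℕ} (hcd : c < d) (hd : d < R.card) :
    Nat.nth (· ∈ R) c < Nat.nth (· ∈ R) d :=
  Nat.nth_lt_nth_of_lt_card R.finite_toSet hcd (by rwa [card_toFinset_mem])

theorem nth_finset_inj {R : Finset ℕ} {c d : ℕ} (hc : c < R.card) (hd : d < R.card)
    (h : Nat.nth (· ∈ R) c = Nat.nth (· ∈ R) d) : c = d := by
  rcases lt_trichotomy c d with hcd | hcd | hcd
  · exact absurd h (nth_finset_lt hcd hd).ne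
  · exact hcd
  · exact absurd h (nth_finset_lt hcd hc).ne'

theorem exists_nth_finset {R : Finset ℕ} {j : ℕ} (hj : j ∈ R) :
    ∃ c < R.card, Nat.nth (· ∈ R) c = j := by
  obtain ⟨c, hc, h⟩ := Nat.exists_lt_card_finite_nth_eq (p := (· ∈ R)) R.finite_toSet hj
  exact ⟨c, by rwa [card_toFinset_mem] at hc, h⟩

/-- The places up to `n` where the letter `b` stands. -/
def places (r : ℕ → Bool) (n : ℕ) (b : Bool) : Finset ℕ := (Finset.Icc 1 n).filter fun j => r j = b

/-- This is the column condition. If it failed, the initial segment ending at the `false` of index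
`c` (counted from `0`) would have at least `c + 1` letters `false` and at most `c` letters `true`.
-/
theorem nth_places_lt {r : ℕ → Bool} {n : ℕ} (hb : Ballot (wordOf r n)) {c : ℕ}
    (h0 : c < (places r n true).card) (h1 : c < (places r n false).card) :
    Nat.nth (· ∈ places r n true) c < Nat.nth (· ∈ places r n false) c := by
  by_contra hlt
  set j := Nat.nth (· ∈ places r n false) c with hj
  have hjm : j ∈ places r n false := nth_mem_finset h1
  have hjm' := hjm
  rw [places, Finset.mem_filter, Finset.mem_Icc] at hjm'
  have hle := (ballot_wordOf_iff r n).1 hb j hjm'.1.2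
  rw [count_wordOf, count_wordOf] at hle
  have hA : c + 1 ≤ ((Finset.Icc 1 j).filter fun x => r x = false).card := by
    rw [← Finset.card_range (c + 1)]
    refine Finset.card_le_card_of_injOn (fun d => Nat.nth (· ∈ places r n false) d) ?_ ?_
    · intro d hd
      have hd' : d < c + 1 := by simpa using hd
      have hm : Nat.nth (· ∈ places r n false) d ∈ places r n false :=
        nth_mem_finset (by omega)
      have hdj : Nat.nth (· ∈ places r n false) d ≤ j := by
        rcases Nat.lt_or_ge d c with h | h
        · exact (nth_finset_lt h h1).le
        · rw [show d = c by omega]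
      have hm' := Finset.mem_filter.1 hm
      exact Finset.mem_coe.2 (Finset.mem_filter.2
        ⟨Finset.mem_Icc.2 ⟨(Finset.mem_Icc.1 hm'.1).1, hdj⟩, hm'.2⟩)
    · intro d hd e he
      have hd' : d < c + 1 := by simpa using hd
      have he' : e < c + 1 := by simpa using he
      exact nth_finset_inj (by omega) (by omega)
  have hB : ((Finset.Icc 1 j).filter fun x => r x = true).card ≤ c := by
    rw [← Finset.card_range c]
    refine le_trans (Finset.card_le_card ?_)
      (Finset.card_image_le (f := fun d => Nat.nth (· ∈ places r n true) d))
    intro x hx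
    rw [Finset.mem_filter, Finset.mem_Icc] at hx
    have hxp : x ∈ places r n true := by
      rw [places, Finset.mem_filter, Finset.mem_Icc]
      exact ⟨⟨hx.1.1, by omega⟩, hx.2⟩
    obtain ⟨d, hd, rfl⟩ := exists_nth_finset hxp
    refine Finset.mem_image.2 ⟨d, Finset.mem_range.2 ?_, rfl⟩
    by_contra hdc
    have hle' : Nat.nth (· ∈ places r n true) c ≤ Nat.nth (· ∈ places r n true) d := by
      rcases Nat.lt_or_ge c d with h | h
      · exact (nth_finset_lt h hd).le
      · rw [show d = c by omega]
    obtain heq : Nat.nth (· ∈ places r n true) c = j := by omega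
    have : j ∈ places r n true := heq ▸ nth_mem_finset h0
    rw [places, Finset.mem_filter] at this
    rw [this.2] at hjm'
    exact absurd hjm'.2 (by decide)
  omega

/-- Each row is filled with the places of its letter in increasing order. -/
theorem exists_tabWord_eq {m k : ℕ} (h : k ≤ m) {w : List Bool} (hw : w ∈ ballotWords (m + k) k) :
    ∃ T : SYT (twoRow m k h), tabWord T = w := by
  classical
  rw [ballotWords, Finset.mem_filter, mem_words] at hw
  obtain ⟨hl, hb, hc⟩ := hw
  obtain ⟨r, hr⟩ := exists_eq_wordOf w
  rw [hl] at hr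
  subst hr
  have hc1 : (places r (m + k) false).card = k := by rw [places, ← count_wordOf, hc]
  have hc0 : (places r (m + k) true).card = m := by
    have := count_true_add_count_false (wordOf r (m + k))
    rw [places, ← count_wordOf]
    omega
  let t : ℕ → ℕ → ℕ := fun i c => Nat.nth (· ∈ places r (m + k) (decide (i = 0))) c
  have hcard : ∀ i c, (i, c) ∈ (twoRow m k h).cells →
      c < (places r (m + k) (decide (i = 0))).card := by
    intro i c hic
    rcases mem_twoRow.1 hic with ⟨rfl, hc⟩ | ⟨rfl, hc⟩
    · simpa [hc0] using hc
    · simpa [hc1] using hc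
  have hmem : ∀ i c, (i, c) ∈ (twoRow m k h).cells →
      t i c ∈ Finset.Icc 1 (m + k) ∧ r (t i c) = decide (i = 0) := fun i c hic =>
    Finset.mem_filter.1 (nth_mem_finset (hcard i c hic))
  let F : (twoRow m k h).cells → Finset.Icc 1 (twoRow m k h).card := fun c =>
    ⟨t c.1.1 c.1.2, by rw [card_twoRow]; exact (hmem _ _ c.2).1⟩
  have hF : Function.Bijective F := by
    rw [Fintype.bijective_iff_injective_and_card]
    constructor
    · rintro ⟨⟨i, c⟩, hc⟩ ⟨⟨i', d⟩, hd⟩ hcd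
      have hcd' : t i c = t i' d := congrArg Subtype.val hcd
      have hii : i = i' := by
        have h1 := (hmem i c hc).2
        rw [hcd', (hmem i' d hd).2, decide_eq_decide] at h1
        have := mem_twoRow.1 hc
        have := mem_twoRow.1 hd
        omega
      subst hii
      obtain rfl := nth_finset_inj (hcard i c hc) (hcard i d hd) hcd'
      rfl
    -- Both sides have as many elements as the diagram has cells, so injectivity suffices.
    · simp [YoungDiagram.card]
  let T : SYT (twoRow m k h) := ⟨Equiv.ofBijective F hF, by
    constructor
    · rintro ⟨⟨i, c⟩, hc⟩ ⟨⟨i', d⟩, hd⟩ hii hcd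
      simp only at hii hcd
      subst hii
      exact nth_finset_lt hcd (hcard i d hd)
    · rintro ⟨⟨i, c⟩, hc⟩ ⟨⟨i', d⟩, hd⟩ hcd hii
      simp only at hii hcd
      subst hcd
      obtain rfl : i = 0 := by have := mem_twoRow.1 hd; omega
      obtain rfl : i' = 1 := by have := mem_twoRow.1 hd; omega
      exact nth_places_lt hb (hcard _ _ hc) (hcard _ _ hd)⟩
  refine ⟨T, ?_⟩
  rw [tabWord, card_twoRow, wordOf_eq_iff]
  intro j hj
  obtain ⟨⟨⟨i, c⟩, hc⟩, hT⟩ := T.1.surjective ⟨j, by rwa [card_twoRow]⟩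
  have hTj : t i c = j := congrArg Subtype.val hT
  have hrow : InRow T i j := ⟨_, congrArg Subtype.val hT, rfl⟩
  rw [← hTj, (hmem i c hc).2, decide_eq_decide, hTj]
  exact ⟨fun h0 => hrow.unique h0, fun hi => hi ▸ hrow⟩

theorem fTwoRow_eq_sum_ballotWords {n k : ℕ} (hk : k ≤ n / 2) (i : ℕ) :
    fTwoRow (n - k) k i =
      ∑ w ∈ ballotWords n k with (wordDes w).card = i, X ^ (∑ j ∈ wordDes w, j) := by
  have h : k ≤ n - k := by omega
  have hn : n - k + k = n := by omega
  rw [fTwoRow, dif_pos h, f]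
  refine Finset.sum_bij (fun T _ => tabWord T) ?_ ?_ ?_ ?_
  · intro T hT
    have := tabWord_mem T
    rw [hn] at this
    rw [Finset.mem_filter] at hT ⊢
    exact ⟨this, by rw [wordDes_tabWord]; exact hT.2⟩
  · exact fun T _ T' _ hT => tabWord_injective hT
  · intro w hw
    rw [Finset.mem_filter] at hw
    obtain ⟨T, rfl⟩ := exists_tabWord_eq h (hn.symm ▸ hw.1)
    exact ⟨T, by simpa [wordDes_tabWord] using hw.2, rfl⟩
  · intro T _
    rw [tabMaj, wordDes_tabWord]

/-! ### The number of ballot words -/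

theorem card_ballotWords_zero_right (n : ℕ) : (ballotWords n 0).card = 1 := by
  rw [Finset.card_eq_one]
  refine ⟨List.replicate n true, ?_⟩
  ext w
  simp only [ballotWords, Finset.mem_filter, mem_words, Finset.mem_singleton]
  constructor
  · rintro ⟨rfl, -, h⟩
    rw [List.eq_replicate_iff]
    refine ⟨rfl, fun b hb => ?_⟩
    cases b with
    | true => rfl
    | false => exact absurd hb (List.count_eq_zero.1 h)
  · rintro rfl
    refine ⟨by simp, ?_, by simp [List.count_replicate]⟩
    simpa [Ballot] using (ballot_replicate_true_append (x := n) (l := []))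

theorem card_ballotWords_of_lt {n k : ℕ} (h : n < 2 * k) : (ballotWords n k).card = 0 := by
  rw [Finset.card_eq_zero, Finset.eq_empty_iff_forall_notMem]
  intro w hw
  simp only [ballotWords, Finset.mem_filter, mem_words] at hw
  have h1 := hw.2.1.count_le
  have h2 := count_true_add_count_false w
  omega

/-- Words are split by their last letter. The bound on `k` ensures that a letter `false` may follow
every ballot word of length `n` with `k` letters `false`. -/
theorem card_ballotWords_succ {n k : ℕ} (h : 2 * (k + 1) ≤ n + 1) :
    (ballotWords (n + 1) (k + 1)).card =
      (ballotWords n (k + 1)).card + (ballotWords n k).card := by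
  have : ballotWords (n + 1) (k + 1) =
      ((ballotWords n (k + 1)).map ⟨List.cons true, List.cons_injective⟩).disjUnion
        ((ballotWords n k).map ⟨List.cons false, List.cons_injective⟩)
        (by simp [Finset.disjoint_left]) := by
    ext w
    rcases w with - | ⟨c, w⟩
    · simp [ballotWords]
    · have h2 := count_true_add_count_false w
      cases c
      · simp only [ballotWords, Finset.mem_filter, mem_words, Finset.mem_disjUnion,
          Finset.mem_map, Function.Embedding.coeFn_mk, List.cons.injEq, ballot_false_cons]
        simp
        omega
      · simp [ballotWords, ballot_true_cons]
  rw [this, Finset.card_disjUnion, Finset.card_map, Finset.card_map]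

/-- The range includes the boundary `2 * k = n + 1`, where both sides vanish, because the recursion
reaches it. -/
theorem card_ballotWords (n k : ℕ) (h : 2 * k ≤ n + 1) : ((ballotWords n k).card : ℚ) =
    (n.choose k : ℚ) * (((n : ℚ) - 2 * k + 1) / ((n : ℚ) - k + 1)) := by
  induction n generalizing k with
  | zero =>
    obtain rfl : k = 0 := by omega
    simp [card_ballotWords_zero_right]
  | succ n ih =>
    rcases k with - | k
    · rw [card_ballotWords_zero_right]
      have : (n : ℚ) + 1 + 1 ≠ 0 := by positivity
      simp [this]
    · by_cases h2 : 2 * (k + 1) = n + 2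
      · rw [card_ballotWords_of_lt (by omega)]
        have : ((n + 1 : ℕ) : ℚ) - 2 * ((k + 1 : ℕ) : ℚ) + 1 = 0 := by
          have : (2 * ((k + 1 : ℕ) : ℚ)) = ((n + 2 : ℕ) : ℚ) := by exact_mod_cast h2
          rw [this]
          push_cast
          ring
        rw [this]
        simp
      · rw [card_ballotWords_succ (by omega), Nat.cast_add, ih (k + 1) (by omega),
          ih k (by omega), Nat.choose_succ_succ]
        have hs : (n.choose (k + 1) : ℚ) * (k + 1) = n.choose k * (n - k) := by
          have := Nat.choose_succ_right_eq n k
          rw [← Nat.cast_sub (by omega : k ≤ n)]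
          exact_mod_cast this
        obtain ⟨d, hd⟩ : ∃ d, n = k + d := ⟨n - k, by omega⟩
        have hdpos : 0 < d := by omega
        subst hd
        have hk : (k : ℚ) + 1 ≠ 0 := by positivity
        have hd0 : (d : ℚ) ≠ 0 := by positivity
        have hd1 : (d : ℚ) + 1 ≠ 0 := by positivity
        have e : ((k + d).choose (k + 1) : ℚ) = (k + d).choose k * d / (k + 1) := by
          rw [eq_div_iff hk, hs]
          push_cast
          ring
        push_cast
        rw [e]
        have e1 : (k : ℚ) + d - (k + 1) + 1 = d := by ring
        have e2 : (k : ℚ) + d - k + 1 = d + 1 := by ring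
        have e3 : (k : ℚ) + d + 1 - (k + 1) + 1 = d + 1 := by ring
        rw [e1, e2, e3]
        field_simp
        ring

/-! ### Grouping by shape and the final identity -/

/-- Each descent is followed by its own letter `false`; this is why the sum may start at `k = i`. -/
theorem card_wordDes_le (w : List Bool) : (wordDes w).card ≤ w.count false := by
  induction w with
  | nil => simp [wordDes]
  | cons c w ih =>
    rw [wordDes]
    split_ifs with h
    · rw [h.1, List.count_cons_self]
      exact (Finset.card_insert_le _ _).trans (by omega)
    · exact ih.trans (List.count_le_count_cons)

/-- Sums over pairs of ballot words, grouped by the number of letters `false`. -/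
theorem sum_ballotPairs {M : Type*} [AddCommMonoid M] (n : ℕ) (g : List Bool → M) :
    ∑ c ∈ ballotPairs n, g c.2 =
      ∑ k ∈ Finset.range (n / 2 + 1), (ballotWords n k).card • ∑ w ∈ ballotWords n k, g w := by
  have hU : ballotPairs n =
      (Finset.range (n / 2 + 1)).biUnion fun k => ballotWords n k ×ˢ ballotWords n k := by
    ext ⟨p, w⟩
    simp only [mem_ballotPairs, Finset.mem_biUnion, Finset.mem_range, Finset.mem_product,
      ballotWords, Finset.mem_filter, mem_words]
    constructor
    · rintro ⟨hp, hw, bp, bw, h⟩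
      have h1 := bw.count_le
      have h2 := count_true_add_count_false w
      exact ⟨w.count false, by omega, ⟨hp, bp, h⟩, hw, bw, rfl⟩
    · rintro ⟨k, -, ⟨hp, bp, h⟩, hw, bw, h'⟩
      exact ⟨hp, hw, bp, bw, h.trans h'.symm⟩
  rw [hU, Finset.sum_biUnion]
  · refine Finset.sum_congr rfl fun k _ => ?_
    rw [Finset.sum_product]
    exact Finset.sum_const (∑ w ∈ ballotWords n k, g w)
  · intro k _ l _ hkl
    rw [Function.onFun, Finset.disjoint_left]
    rintro ⟨p, w⟩ h h'
    simp only [Finset.mem_product, ballotWords, Finset.mem_filter] at h h'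
    exact hkl (h.1.2.2.symm.trans h'.1.2.2)

end MajorIndex

theorem mainTheorem3 (n i : ℕ) :
    MajorIndex.A n i =
      ∑ k ∈ Finset.Icc i (n / 2),
        MajorIndex.fTwoRow (n - k) k i *
          Polynomial.C ((n.choose k : ℚ) * (((n : ℚ) - 2 * k + 1) / ((n : ℚ) - k + 1))) := by
  open MajorIndex Polynomial in
  have h := sum_avoiders_eq_sum_ballotPairs n
    -- The flag and the bound on `v` were needed only for the recursion and are now forgotten.
    fun S _ _ => if S.card = i then (X ^ (∑ j ∈ S, j) : ℚ[X]) else 0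
  rw [sum_ballotPairs n fun w => if (wordDes w).card = i then (X ^ (∑ j ∈ wordDes w, j) : ℚ[X])
    else 0, ← Finset.sum_filter, Finset.filter_filter] at h
  rw [A]
  simp only [permMaj]
  rw [h]
  refine (Finset.sum_subset_zero_on_sdiff (fun k hk => ?_) (fun k hk => ?_) fun k hk => ?_).symm
  · simp at hk ⊢
    omega
  -- The extra terms have `k < i`, too few letters `false` for `i` descents.
  · simp only [Finset.mem_sdiff, Finset.mem_range, Finset.mem_Icc] at hk
    rw [Finset.sum_eq_zero, smul_zero]
    intro w hw
    rw [ballotWords, Finset.mem_filter] at hw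
    have := card_wordDes_le w
    rw [if_neg (by omega)]
  · rw [Finset.mem_Icc] at hk
    rw [fTwoRow_eq_sum_ballotWords hk.2, ← card_ballotWords n k (by omega), Finset.sum_filter,
      nsmul_eq_mul, mul_comm, map_natCast]
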